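/- For a real normed space $Y$, call a set $S\subset Y$ equilateral if there is $p>0$ such that $\|x-y\|=p$ for all distinct $x,y\in S$, and let the equilateral dimension $e(Y)$ be the maximal cardinality of an equilateral set in $Y$. For real normed spaces $X,Y$ let $d(X,Y)=\inf\|T\|\cdot\|T^{-1}\|$ be the (multiplicative) Banach–Mazur distance, where the infimum is taken over all linear isomorphisms $T:X\to Y$ with $T$ and $T^{-1}$ bounded (so $d(X,Y)=\infty$ if there are none). Theorem. Let $a_1,\dots,a_n\in\mathbb{R}$ be such that $$X=\{(x_1,\dots,x_n)\in\mathbb{R}^n : a_1x_1+\dots+a_nx_n=0\}\subset\ell_\infty^n,$$ with the norm $\|x\|_\infty=\max_i|x_i|$, has dimension $n-1$. Let $1\le k\le n$ be an integer for which there exist disjoint sets $A,B\subset\{1,\dots,n\}$ such that $|A|=k$, $|A\cup B|=n-1$ and $\sum_{i\in A}|a_i|\ge\sum_{i\in B}|a_i|$. Then $e(Y)\ge n-k$ for every real normed space $Y$ with $d(X,Y)\le 2$. -/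

import Mathlib

open scoped ENNReal

/-- A set `S` is equilateral if for some `p > 0` all pairs of distinct points of `S` are at
distance exactly `p`. -/
def IsEquilateral {E : Type*} [NormedAddCommGroup E] (S : Set E) : Prop :=
  ∃ p : ℝ, 0 < p ∧ ∀ x ∈ S, ∀ y ∈ S, x ≠ y → ‖x - y‖ = p

/-- The equilateral dimension: the largest cardinality of an equilateral set, as the supremum in
`ℕ∞` (a bounded supremum in `ℕ∞` is attained, so it is then a maximum). -/
noncomputable def equilateralDim (E : Type*) [NormedAddCommGroup E] : ℕ∞ :=
  ⨆ (S : Set E) (_ : IsEquilateral S), S.encard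

/-- The multiplicative Banach–Mazur distance: the infimum of `‖T‖ * ‖T⁻¹‖` over all linear
isomorphisms `T` that are bounded with bounded inverse (every one, in finite dimension).
It is `∞` if there is no such isomorphism. -/
noncomputable def banachMazurDist (E F : Type*) [NormedAddCommGroup E] [NormedSpace ℝ E]
    [NormedAddCommGroup F] [NormedSpace ℝ F] : ℝ≥0∞ :=
  ⨅ T : E ≃L[ℝ] F,
    ENNReal.ofReal (‖(T : E →L[ℝ] F)‖ * ‖(T.symm : F →L[ℝ] E)‖)

/-- The subspace `{x : a₁ x₁ + ⋯ + aₙ xₙ = 0}` of `ℓ_∞ⁿ`; the type `Fin n → ℝ` carries the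
sup norm, and the subspace inherits it. -/
def linftyHyperplane {n : ℕ} (a : Fin n → ℝ) : Submodule ℝ (Fin n → ℝ) where
  carrier := {x | ∑ i, a i * x i = 0}
  add_mem' := by
    intro x y hx hy
    simp only [Set.mem_ofPred_eq, Pi.add_apply, mul_add, Finset.sum_add_distrib] at *
    rw [hx, hy, add_zero]
  zero_mem' := by simp
  smul_mem' := by
    intro c x hx
    simp only [Set.mem_ofPred_eq, Pi.smul_apply, smul_eq_mul, mul_left_comm _ c] at *
    rw [← Finset.mul_sum, hx, mul_zero]

/-! The condition on `A` and `B` places an isometric copy of `ℓ_∞^B`, with `|B| = n - 1 - k`, inside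
`X`: coordinates in `B` are free, and those in `A` restore the linear equation without raising the
norm (`exists_isometry_linftyHyperplane`). By compactness some linear map `X → Y` has distortion at
most 2, and it restricts to this copy. In `ℓ_∞^B` there are `|B| + 1` points whose pairwise
distances are tuned by one parameter per pair; making all image distances equal to 1 is a fixed
point problem on a cube (`card_add_one_le_equilateralDim`). Brouwer's theorem comes from Scarf's
lemma, a parity argument about finite rankings, applied to grid points of a simplex. -/

/-- `D` is dominating for the family of rankings `r` if no point lies strictly above all of `D`'s
minima simultaneously. -/
def IsDominating {ι α L : Type*} [LinearOrder L] (r : ι → α → L) (D : Finset α) : Prop :=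
  ∀ y, ∃ i, ∀ x ∈ D, r i y ≤ r i x

set_option linter.unusedSectionVars false

/-! ### Scarf's lemma -/

section Scarf

variable {ι α L : Type*} [Fintype ι] [DecidableEq ι] [Fintype α] [DecidableEq α] [LinearOrder L]
  {r : ι → α → L}

theorem IsDominating.mono {D E : Finset α} (hD : IsDominating r D) (h : E ⊆ D) :
    IsDominating r E := fun y => (hD y).imp fun _ hi x hx => hi x (h hx)

/-- In a dominating set with one element fewer than there are rankings, exactly one pair of
rankings shares its minimum. -/
theorem IsDominating.exists_min_pair (hr : ∀ i, Function.Injective (r i)) {E : Finset α}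
    (hE : IsDominating r E) (hne : E.Nonempty) (hcard : E.card + 1 = Fintype.card ι) :
    ∃ m : ι → α, (∀ i, m i ∈ E) ∧ (∀ i, ∀ x ∈ E, r i (m i) ≤ r i x) ∧
      (∀ x ∈ E, ∃ i, m i = x) ∧ ∃ i j, i ≠ j ∧ m i = m j ∧
        ∀ a b, m a = m b → a ≠ b → (a = i ∧ b = j) ∨ (a = j ∧ b = i) := by
  choose m hmE hm using fun i => E.exists_min_image (r i) hne
  have hsurj : ∀ x ∈ E, ∃ i, m i = x := by
    intro x hx
    obtain ⟨i, hi⟩ := hE x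
    exact ⟨i, hr i (le_antisymm (hm i x hx) (hi _ (hmE i)))⟩
  obtain ⟨i, -, j, -, hij, hmij⟩ := Finset.exists_ne_map_eq_of_card_lt_of_maps_to
    (s := (Finset.univ : Finset ι)) (t := E) (f := m)
    (by rw [Finset.card_univ]; omega) (fun i _ => hmE i)
  -- Dropping one of two colliding rankings keeps `m` onto `E`, so by counting it is injective on
  -- the rest; using this for `i` and for `j` leaves no other collision.
  have key : ∀ i j, i ≠ j → m i = m j → ∀ a b, a ≠ j → b ≠ j → m a = m b → a = b := by
    intro i j hij hmij a b ha hb hab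
    have hinj : Set.InjOn m (Finset.univ.erase j : Finset ι) := by
      apply Finset.injOn_of_card_image_eq
      rw [Finset.card_erase_of_mem (Finset.mem_univ _), Finset.card_univ, ← hcard,
        Nat.add_sub_cancel]
      congr 1
      ext x
      simp only [Finset.mem_image, Finset.mem_erase, Finset.mem_univ, and_true]
      constructor
      · rintro ⟨l, -, rfl⟩
        exact hmE l
      · intro hx
        obtain ⟨l, rfl⟩ := hsurj x hx
        by_cases hl : l = j
        · exact ⟨i, hij, by rw [hl, hmij]⟩
        · exact ⟨l, hl, rfl⟩
    exact hinj (by simpa using ha) (by simpa using hb) hab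
  refine ⟨m, hmE, hm, hsurj, i, j, hij, hmij, fun a b hab hne => ?_⟩
  by_contra hcon
  have h1 := key i j hij hmij a b
  have h2 := key j i hij.symm hmij.symm a b
  grind

/-- `y` is the highest point in ranking `i` among those lying above the minima `m l` in all
other rankings `l`. -/
def IsReplacement (r : ι → α → L) (m : ι → α) (i : ι) (y : α) : Prop :=
  (∀ l, l ≠ i → r l (m l) < r l y) ∧
    ∀ z, (∀ l, l ≠ i → r l (m l) < r l z) → r i z ≤ r i y

theorem exists_isReplacement {m : ι → α} {i : ι} (h : ∃ z, ∀ l, l ≠ i → r l (m l) < r l z) :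
    ∃ y, IsReplacement r m i y := by
  classical
  obtain ⟨z, hz⟩ := h
  obtain ⟨y, hy, hmax⟩ := (Finset.univ.filter fun z => ∀ l, l ≠ i → r l (m l) < r l z).exists_max_image
    (r i) ⟨z, by simpa using hz⟩
  exact ⟨y, by simpa using hy, fun z hz => hmax z (by simpa using hz)⟩

/-- A point above all minima but the `i`-th can only be blocked in ranking `i`, where `y` is highest
among such points; any other point is blocked by some minimum lying below `y`. -/
theorem IsDominating.insert_of_isReplacement {E : Finset α} (hE : IsDominating r E) {m : ι → α}
    (hm : ∀ i, ∀ x ∈ E, r i (m i) ≤ r i x) (hsurj : ∀ x ∈ E, ∃ i, m i = x) (hmE : ∀ i, m i ∈ E)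
    {i j : ι} (hij : i ≠ j) (hmij : m i = m j) {y : α} (hy : IsReplacement r m i y) :
    y ∉ E ∧ IsDominating r (insert y E) := by
  constructor
  · intro hyE
    obtain ⟨l, rfl⟩ := hsurj y hyE
    by_cases hl : l = i
    · subst hl
      have := hy.1 j hij.symm
      rw [← hmij] at this
      exact lt_irrefl _ this
    · exact lt_irrefl _ (hy.1 l hl)
  · intro z
    by_cases hz : ∀ l, l ≠ i → r l (m l) < r l z
    · obtain ⟨l, hl⟩ := hE z
      have hli : l = i := by
        by_contra hne
        exact absurd (hl _ (hmE l)) (not_le.2 (hz l hne))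
      subst hli
      refine ⟨l, fun x hx => ?_⟩
      rcases Finset.mem_insert.1 hx with rfl | hx
      · exact hy.2 z hz
      · exact hl x hx
    · push Not at hz
      obtain ⟨l, hl, hzl⟩ := hz
      refine ⟨l, fun x hx => ?_⟩
      rcases Finset.mem_insert.1 hx with rfl | hx
      · exact hzl.trans (hy.1 l hl).le
      · exact hzl.trans (hm l x hx)

/-- In the enlarged set every element is still minimal in some ranking, and `y` takes over a ranking
`l₀`. The former minimum of `l₀` must be minimal elsewhere too, so `l₀` belongs to the colliding
pair. -/
theorem IsDominating.insert_iff (hr : ∀ i, Function.Injective (r i)) {E : Finset α}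
    (hE : IsDominating r E) {m : ι → α} (hmE : ∀ i, m i ∈ E)
    (hm : ∀ i, ∀ x ∈ E, r i (m i) ≤ r i x) (hsurj : ∀ x ∈ E, ∃ i, m i = x)
    {i j : ι} (hij : i ≠ j) (hmij : m i = m j)
    (huniq : ∀ a b, m a = m b → a ≠ b → (a = i ∧ b = j) ∨ (a = j ∧ b = i)) (y : α) :
    (y ∉ E ∧ IsDominating r (insert y E)) ↔ IsReplacement r m i y ∨ IsReplacement r m j y := by
  constructor
  · rintro ⟨hyE, hD⟩
    obtain ⟨l₀, hl₀⟩ := hD y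
    choose ν hν using fun x => hD x
    have hmν : ∀ x ∈ E, m (ν x) = x := fun x hx =>
      hr (ν x) (le_antisymm (hm _ x hx) (hν x _ (Finset.mem_insert_of_mem (hmE _))))
    have hν₀ : ∀ x ∈ E, ν x ≠ l₀ := by
      intro x hx h
      have h1 := hν x y (Finset.mem_insert_self _ _)
      have h2 := hl₀ x (Finset.mem_insert_of_mem hx)
      rw [h] at h1
      exact hyE ((hr l₀ (le_antisymm h1 h2)) ▸ hx)
    have hmem : l₀ = i ∨ l₀ = j := by
      have h1 := hmν _ (hmE l₀)
      have h2 := hν₀ _ (hmE l₀)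
      rcases huniq _ _ h1 h2 with h | h
      · exact Or.inr h.2
      · exact Or.inl h.2
    have habove : ∀ l, l ≠ l₀ → r l (m l) < r l y := by
      intro l hl
      have h1 := hmν _ (hmE l)
      have h2 := hν₀ _ (hmE l)
      have h3 : ν (m l) = l := by
        by_contra hne
        have := huniq _ _ h1 hne
        grind
      have h4 := hν (m l) y (Finset.mem_insert_self _ _)
      rw [h3] at h4
      exact lt_of_le_of_ne h4 fun h => hyE ((hr l h) ▸ hmE l)
    have hrep : IsReplacement r m l₀ y := by
      refine ⟨habove, fun z hz => ?_⟩
      obtain ⟨l, hl⟩ := hD z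
      have : l = l₀ := by
        by_contra hne
        exact absurd (hl _ (Finset.mem_insert_of_mem (hmE l))) (not_le.2 (hz l hne))
      exact this ▸ hl y (Finset.mem_insert_self _ _)
    rcases hmem with rfl | rfl
    · exact Or.inl hrep
    · exact Or.inr hrep
  · rintro (h | h)
    · exact hE.insert_of_isReplacement hm hsurj hmE hij hmij h
    · exact hE.insert_of_isReplacement hm hsurj hmE hij.symm hmij.symm h

theorem IsReplacement.eq (hr : ∀ i, Function.Injective (r i)) {m : ι → α} {i : ι} {y z : α}
    (hy : IsReplacement r m i y) (hz : IsReplacement r m i z) : y = z :=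
  hr i (le_antisymm (hz.2 y hy.1) (hy.2 z hz.1))

theorem IsReplacement.not_of_ne {E : Finset α} (hE : IsDominating r E) {m : ι → α}
    (hmE : ∀ i, m i ∈ E) {i j : ι} (hij : i ≠ j) {y : α} (hy : IsReplacement r m i y) :
    ¬ IsReplacement r m j y := by
  intro hy'
  obtain ⟨l, hl⟩ := hE y
  have h := hl _ (hmE l)
  by_cases hli : l = i
  · exact absurd h (not_le.2 (hy'.1 l (hli ▸ hij)))
  · exact absurd h (not_le.2 (hy.1 l hli))

open Classical in
/-- A dominating set with one element fewer than there are rankings and containing a non-slack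
point extends to a larger dominating set in exactly two ways. -/
theorem IsDominating.card_insert_eq_two (hr : ∀ i, Function.Injective (r i)) {s : ι → α}
    (hs : ∀ i j y, i ≠ j → y ∉ Set.range s → r i y < r i (s j)) {E : Finset α}
    (hE : IsDominating r E) (hcard : E.card + 1 = Fintype.card ι) {t : α} (htE : t ∈ E)
    (ht : t ∉ Set.range s) :
    (Finset.univ.filter fun y => y ∉ E ∧ IsDominating r (insert y E)).card = 2 := by
  obtain ⟨m, hmE, hm, hsurj, i, j, hij, hmij, huniq⟩ := hE.exists_min_pair hr ⟨t, htE⟩ hcard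
  -- The slack point `s i` is a candidate: outside ranking `i` it lies above `t`, hence above the
  -- minima.
  have hex : ∀ i, ∃ y, IsReplacement r m i y := fun i =>
    exists_isReplacement ⟨s i, fun l hl => (hm l t htE).trans_lt (hs l i t hl ht)⟩
  obtain ⟨y, hy⟩ := hex i
  obtain ⟨z, hz⟩ := hex j
  rw [Finset.card_eq_two]
  refine ⟨y, z, ?_, ?_⟩
  · rintro rfl
    exact hy.not_of_ne hE hmE hij hz
  · ext x
    simp only [Finset.mem_filter, Finset.mem_univ, true_and, Finset.mem_insert,
      Finset.mem_singleton, hE.insert_iff hr hmE hm hsurj hij hmij huniq]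
    constructor
    · rintro (h | h)
      · exact Or.inl (h.eq hr hy)
      · exact Or.inr (h.eq hr hz)
    · rintro (rfl | rfl)
      · exact Or.inl hy
      · exact Or.inr hz

theorem isDominating_slack {s : ι → α} (hs₀ : ∀ i y, r i (s i) ≤ r i y)
    (hs : ∀ i j y, i ≠ j → y ∉ Set.range s → r i y < r i (s j)) (i₀ : ι) :
    IsDominating r ((Finset.univ.erase i₀).image s) := by
  intro y
  by_cases hy : y ∈ Set.range s
  · obtain ⟨q, rfl⟩ := hy
    exact ⟨q, fun x _ => hs₀ q x⟩
  · refine ⟨i₀, fun x hx => ?_⟩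
    obtain ⟨l, hl, rfl⟩ := Finset.mem_image.1 hx
    exact (hs i₀ l y (Finset.ne_of_mem_erase hl).symm hy).le

-- The minimum shared with `i₀` is some `s q`. Only `i₀` can be replaced: to replace `q`, a point
-- must beat `s q` in ranking `i₀`, which non-slack points and `s i₀` cannot do, and each remaining
-- slack point is itself a minimum in its own ranking.
open Classical in
theorem card_insert_slack_eq_one [Nontrivial ι] (hr : ∀ i, Function.Injective (r i)) {s : ι → α}
    (hinj : Function.Injective s) (hs₀ : ∀ i y, r i (s i) ≤ r i y)
    (hs : ∀ i j y, i ≠ j → y ∉ Set.range s → r i y < r i (s j)) (i₀ : ι) :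
    (Finset.univ.filter fun y => y ∉ (Finset.univ.erase i₀).image s ∧
      IsDominating r (insert y ((Finset.univ.erase i₀).image s))).card = 1 := by
  set E := (Finset.univ.erase i₀).image s with hEdef
  have hE : IsDominating r E := isDominating_slack hs₀ hs i₀
  have hcard : E.card + 1 = Fintype.card ι := by
    rw [hEdef, Finset.card_image_of_injective _ hinj,
      Finset.card_erase_of_mem (Finset.mem_univ _), Finset.card_univ]
    have := Fintype.card_pos_iff.2 ⟨i₀⟩
    omega
  have hmem : ∀ l, l ≠ i₀ → s l ∈ E := fun l hl =>
    Finset.mem_image_of_mem _ (by simpa using hl)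
  obtain ⟨l, hl⟩ := exists_ne i₀
  obtain ⟨m, hmE, hm, hsurj, i, j, hij, hmij, huniq⟩ := hE.exists_min_pair hr ⟨_, hmem l hl⟩ hcard
  have hms : ∀ l, l ≠ i₀ → m l = s l := fun l hl =>
    hr l (le_antisymm (hm l _ (hmem l hl)) (hs₀ l _))
  -- the shared minimum involves `i₀`
  obtain ⟨q, hq, hq'⟩ := Finset.mem_image.1 (hmE i₀)
  have hqi : q ≠ i₀ := Finset.ne_of_mem_erase hq
  have hmq : m q = m i₀ := by rw [hms q hqi, hq']
  have hiff : ∀ y, (y ∉ E ∧ IsDominating r (insert y E)) ↔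
      IsReplacement r m i₀ y ∨ IsReplacement r m q y := by
    intro y
    refine hE.insert_iff hr hmE hm hsurj hqi.symm hmq.symm (fun a b hab hne => ?_) y
    have h1 := huniq a b hab hne
    have h2 := huniq q i₀ hmq hqi
    grind
  have hnone : ∀ y, ¬ IsReplacement r m q y := by
    intro y hy
    have h0 := hy.1 i₀ hqi.symm
    rw [← hq'] at h0
    by_cases hys : y ∈ Set.range s
    · obtain ⟨p, rfl⟩ := hys
      by_cases hpq : p = q
      · subst hpq
        exact lt_irrefl _ h0
      · by_cases hp : p = i₀
        · subst hp
          exact absurd (hs₀ p (s q)) (not_le.2 h0)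
        · have := hy.1 p hpq
          rw [hms p hp] at this
          exact lt_irrefl _ this
    · exact lt_asymm h0 (hs i₀ q y hqi.symm hys)
  obtain ⟨y, hy⟩ : ∃ y, IsReplacement r m i₀ y := exists_isReplacement ⟨s i₀, fun l hl => by
    rw [hms l hl]
    exact lt_of_le_of_ne (hs₀ l _) fun h => hl (hinj (hr l h))⟩
  rw [Finset.card_eq_one]
  refine ⟨y, ?_⟩
  ext x
  simp only [Finset.mem_filter, Finset.mem_univ, true_and, Finset.mem_singleton, hiff]
  constructor
  · rintro (h | h)
    · exact h.eq hr hy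
    · exact absurd h (hnone x)
  · rintro rfl
    exact Or.inl hy

/-- A set which does not carry all colours has an even number of elements whose removal leaves
exactly the colours other than `i₀`. -/
theorem even_card_erase_colors {c : α → ι} {i₀ : ι} {D : Finset α}
    (hcard : D.card = Fintype.card ι) (hD : D.image c ≠ Finset.univ) :
    Even (D.filter fun x => (D.erase x).image c = Finset.univ.erase i₀).card := by
  by_cases hne : (D.filter fun x => (D.erase x).image c = Finset.univ.erase i₀) = ∅
  · simp [hne]
  obtain ⟨x₀, hx₀⟩ := Finset.nonempty_iff_ne_empty.2 hne
  obtain ⟨hxD, hx₀⟩ := Finset.mem_filter.1 hx₀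
  have hinj : Set.InjOn c (D.erase x₀ : Finset α) := by
    apply Finset.injOn_of_card_image_eq
    rw [hx₀, Finset.card_erase_of_mem hxD, hcard, Finset.card_erase_of_mem (Finset.mem_univ _),
      Finset.card_univ]
  have hc₀ : c x₀ ≠ i₀ := by
    intro h
    apply hD
    rw [← Finset.insert_erase hxD, Finset.image_insert, hx₀, h,
      Finset.insert_erase (Finset.mem_univ _)]
  have hmem : c x₀ ∈ (D.erase x₀).image c := by rw [hx₀]; simpa using hc₀
  obtain ⟨x₁, hx₁, hc₁⟩ := Finset.mem_image.1 hmem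
  have hx₁D := Finset.mem_of_mem_erase hx₁
  have hne' := Finset.ne_of_mem_erase hx₁
  have hcol : ∀ j, j ≠ i₀ ↔ ∃ x, x ≠ x₀ ∧ x ∈ D ∧ c x = j := by
    intro j
    have := Finset.ext_iff.1 hx₀ j
    simp only [Finset.mem_image, Finset.mem_erase, Finset.mem_univ, and_true] at this
    rw [← this]
    simp [and_assoc]
  -- The set lacks exactly `i₀`, so one colour occurs twice, at `x₀` and `x₁`; these are the only
  -- removable points.
  have hset : (D.filter fun x => (D.erase x).image c = Finset.univ.erase i₀) = {x₀, x₁} := by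
    ext x
    simp only [Finset.mem_filter, Finset.mem_insert, Finset.mem_singleton]
    constructor
    · rintro ⟨hx, himg⟩
      by_contra hcon
      push Not at hcon
      have hcx : c x ∈ (D.erase x).image c := by
        rw [himg]
        simpa using (hcol (c x)).2 ⟨x, hcon.1, hx, rfl⟩
      obtain ⟨z, hz, hzc⟩ := Finset.mem_image.1 hcx
      have hzD := Finset.mem_of_mem_erase hz
      have hzx := Finset.ne_of_mem_erase hz
      have hxm : x ∈ D.erase x₀ := Finset.mem_erase.2 ⟨hcon.1, hx⟩
      by_cases hz0 : z = x₀
      · subst hz0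
        exact hcon.2 (hinj hxm hx₁ (by rw [hc₁, hzc]))
      · exact hzx (hinj (Finset.mem_erase.2 ⟨hz0, hzD⟩) hxm hzc)
    · rintro (rfl | rfl)
      · exact ⟨hxD, hx₀⟩
      · refine ⟨hx₁D, ?_⟩
        ext j
        simp only [Finset.mem_image, Finset.mem_erase, Finset.mem_univ, and_true]
        rw [hcol]
        constructor
        · rintro ⟨z, ⟨hz1, hzD⟩, rfl⟩
          by_cases hz0 : z = x₀
          · exact ⟨x, hne', hx₁D, by rw [hz0, hc₁]⟩
          · exact ⟨z, hz0, hzD, rfl⟩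
        · rintro ⟨z, hz0, hzD, rfl⟩
          by_cases hz1 : z = x
          · exact ⟨x₀, ⟨hne'.symm, hxD⟩, by rw [hz1, hc₁]⟩
          · exact ⟨z, ⟨hz1, hzD⟩, rfl⟩
  rw [hset, Finset.card_pair hne'.symm]
  exact even_two

/-- **Scarf's lemma**: for a colouring which gives the slack point `s i` colour `i`, some
dominating set carries every colour exactly once. -/
theorem exists_isDominating_image_eq_univ [Nontrivial ι] (hr : ∀ i, Function.Injective (r i))
    {s : ι → α} (hs₀ : ∀ i y, r i (s i) ≤ r i y)
    (hs : ∀ i j y, i ≠ j → y ∉ Set.range s → r i y < r i (s j)) {c : α → ι}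
    (hc : ∀ i, c (s i) = i) :
    ∃ D : Finset α, IsDominating r D ∧ D.card = Fintype.card ι ∧ D.image c = Finset.univ := by
  classical
  by_contra hcon
  push Not at hcon
  have hinj : Function.Injective s := fun a b h => by rw [← hc a, h, hc b]
  obtain ⟨i₀⟩ : Nonempty ι := inferInstance
  -- Count incident pairs of a door and a room. The all-slack door lies in one room and every other
  -- door in two, so the total is odd; without a fully coloured room each room has evenly many
  -- doors.
  set doors : Finset (Finset α) := Finset.univ.filter fun E =>
    IsDominating r E ∧ E.card + 1 = Fintype.card ι ∧ E.image c = Finset.univ.erase i₀ with hdoors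
  set rooms : Finset (Finset α) := Finset.univ.filter fun D =>
    IsDominating r D ∧ D.card = Fintype.card ι with hrooms
  have hcount : ∑ E ∈ doors, (Finset.univ.filter fun y => y ∉ E ∧ IsDominating r (insert y E)).card
      = ∑ D ∈ rooms, (D.filter fun x => (D.erase x).image c = Finset.univ.erase i₀).card := by
    rw [← Finset.card_sigma, ← Finset.card_sigma]
    refine Finset.card_nbij' (fun p => ⟨insert p.2 p.1, p.2⟩) (fun p => ⟨p.1.erase p.2, p.2⟩)
      ?_ ?_ ?_ ?_
    · rintro ⟨E, y⟩ h
      simp only [hdoors, Finset.coe_sigma, Set.mem_sigma_iff, Finset.mem_coe, Finset.mem_filter,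
        Finset.mem_univ, true_and] at h
      obtain ⟨⟨hE, hcard, himg⟩, hyE, hD⟩ := h
      simp only [hrooms, Finset.coe_sigma, Set.mem_sigma_iff, Finset.mem_coe, Finset.mem_filter,
        Finset.mem_univ, true_and]
      exact ⟨⟨hD, by rw [Finset.card_insert_of_notMem hyE, hcard]⟩, Finset.mem_insert_self _ _,
        by rw [Finset.erase_insert hyE, himg]⟩
    · rintro ⟨D, x⟩ h
      simp only [hrooms, Finset.coe_sigma, Set.mem_sigma_iff, Finset.mem_coe, Finset.mem_filter,
        Finset.mem_univ, true_and] at h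
      obtain ⟨⟨hD, hcard⟩, hxD, himg⟩ := h
      simp only [hdoors, Finset.coe_sigma, Set.mem_sigma_iff, Finset.mem_coe, Finset.mem_filter,
        Finset.mem_univ, true_and]
      exact ⟨⟨hD.mono (Finset.erase_subset _ _), by rw [Finset.card_erase_add_one hxD, hcard],
        himg⟩, Finset.notMem_erase _ _, by rwa [Finset.insert_erase hxD]⟩
    · rintro ⟨E, y⟩ h
      simp only [Finset.coe_sigma, Set.mem_sigma_iff, Finset.mem_coe, Finset.mem_filter,
        Finset.mem_univ, true_and] at h
      simp [Finset.erase_insert h.2.1]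
    · rintro ⟨D, x⟩ h
      simp only [Finset.coe_sigma, Set.mem_sigma_iff, Finset.mem_coe, Finset.mem_filter] at h
      simp [Finset.insert_erase h.2.1]
  have heven : Even (∑ D ∈ rooms,
      (D.filter fun x => (D.erase x).image c = Finset.univ.erase i₀).card) := by
    refine Finset.even_sum _ fun D hD => ?_
    obtain ⟨hD, hcard⟩ := (Finset.mem_filter.1 hD).2
    exact even_card_erase_colors hcard (hcon D hD hcard)
  set E₀ := (Finset.univ.erase i₀).image s with hE₀
  have himg₀ : E₀.image c = Finset.univ.erase i₀ := by
    rw [hE₀, Finset.image_image]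
    simp [Function.comp_def, hc]
  have hE₀mem : E₀ ∈ doors := by
    refine Finset.mem_filter.2 ⟨Finset.mem_univ _, isDominating_slack hs₀ hs i₀, ?_, himg₀⟩
    rw [hE₀, Finset.card_image_of_injective _ hinj, Finset.card_erase_add_one (Finset.mem_univ _),
      Finset.card_univ]
  rw [← hcount, ← Finset.add_sum_erase _ _ hE₀mem, hE₀,
    card_insert_slack_eq_one hr hinj hs₀ hs i₀, ← hE₀] at heven
  have heven' : Even (∑ E ∈ doors.erase E₀,
      (Finset.univ.filter fun y => y ∉ E ∧ IsDominating r (insert y E)).card) := by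
    refine Finset.even_sum _ fun E hE => ?_
    obtain ⟨hne, hE⟩ := Finset.mem_erase.1 hE
    obtain ⟨hdom, hcard, himg⟩ := (Finset.mem_filter.1 hE).2
    have : ∃ t ∈ E, t ∉ Set.range s := by
      by_contra hall
      push Not at hall
      apply hne
      refine Finset.eq_of_subset_of_card_le (fun x hx => ?_) ?_
      · obtain ⟨i, rfl⟩ := hall x hx
        have : c (s i) ∈ E.image c := Finset.mem_image_of_mem _ hx
        rw [himg, hc] at this
        exact Finset.mem_image_of_mem _ this
      · rw [hE₀, Finset.card_image_of_injective _ hinj,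
          Finset.card_erase_of_mem (Finset.mem_univ _), Finset.card_univ]
        omega
    obtain ⟨t, htE, ht⟩ := this
    rw [hdom.card_insert_eq_two hr hs hcard htE ht]
    exact even_two
  exact absurd heven (by rw [Nat.not_even_iff_odd]; exact heven'.one_add)

end Scarf

/-! ### Brouwer's fixed point theorem -/

section Brouwer

variable {ι : Type*} [Fintype ι]

/-- A colouring of the points of the grid `{x : ι → ℕ | ∑ x = K}` has a spot `x₀` near which every
colour `i` occurs, unless `x₀ i` is small. -/
theorem exists_grid_point_near_colors [Nontrivial ι] (K : ℕ) (c : (ι → ℕ) → ι) :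
    ∃ x₀ : ι → ℕ, ∑ i, x₀ i = K ∧ ∀ i, x₀ i ≤ Fintype.card ι ∨
      ∃ x : ι → ℕ, ∑ i, x i = K ∧ c x = i ∧
        ∀ l, x l ≤ x₀ l + Fintype.card ι ∧ x₀ l ≤ x l + Fintype.card ι := by
  classical
  let G := Finset.piAntidiag (Finset.univ : Finset ι) K
  have hG : ∀ x : ι → ℕ, x ∈ G ↔ ∑ i, x i = K := fun x => by simp [G]
  -- Grid points get values from 1 to `K + 1`, so 0 and `K + 2` put slack points strictly below or
  -- above them; the enumeration in `r` breaks ties.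
  let w : ι → G ⊕ ι → ℕ := fun i => Sum.elim (fun x => x.1 i + 1)
    (fun j => if i = j then 0 else K + 2)
  let r : ι → G ⊕ ι → ℕ ×ₗ ℕ := fun i y => toLex (w i y, (Fintype.equivFin (G ⊕ ι) y : ℕ))
  have hr : ∀ i, Function.Injective (r i) := by
    intro i y z h
    have h2 := congrArg (fun p => (ofLex p).2) h
    exact (Fintype.equivFin (G ⊕ ι)).injective (Fin.ext h2)
  have hle : ∀ i y z, r i y ≤ r i z → w i y ≤ w i z := by
    intro i y z h
    rcases Prod.Lex.toLex_le_toLex.1 h with h | h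
    · exact h.le
    · exact h.1.le
  have hlt : ∀ i y z, w i y < w i z → r i y < r i z := fun i y z h =>
    Prod.Lex.toLex_lt_toLex.2 (Or.inl h)
  have hGle : ∀ (x : G) i, x.1 i ≤ K := fun x i => by
    rw [← (hG x.1).1 x.2]
    exact Finset.single_le_sum (fun _ _ => Nat.zero_le _) (Finset.mem_univ i)
  have hs₀ : ∀ i (y : G ⊕ ι), r i (Sum.inr i) ≤ r i y := by
    intro i y
    by_cases hy : y = Sum.inr i
    · rw [hy]
    · refine (hlt _ _ _ ?_).le
      rcases y with x | j
      · simp [w]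
      · have : i ≠ j := fun h => hy (by rw [h])
        simp [w, this]
  have hs : ∀ i j (y : G ⊕ ι), i ≠ j → y ∉ Set.range (Sum.inr : ι → G ⊕ ι) →
      r i y < r i (Sum.inr j) := by
    intro i j y hij hy
    rcases y with x | q
    · apply hlt
      have := hGle x i
      simp only [w, Sum.elim_inl, Sum.elim_inr, if_neg hij]
      omega
    · exact absurd ⟨q, rfl⟩ hy
  obtain ⟨D, hD, hcard, himg⟩ := exists_isDominating_image_eq_univ hr hs₀ hs
    (c := Sum.elim (fun x : G => c x.1) id) (fun i => rfl)
  obtain ⟨i₀⟩ : Nonempty ι := inferInstance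
  -- the rankings whose slack point is not used
  let C : Finset ι := Finset.univ.filter fun i => Sum.inr i ∉ D
  have hcol : ∀ i ∈ C, ∃ x : G, Sum.inl x ∈ D ∧ c x.1 = i := by
    intro i hi
    have : i ∈ D.image (Sum.elim (fun x : G => c x.1) id) := by rw [himg]; exact Finset.mem_univ _
    obtain ⟨y, hy, hyi⟩ := Finset.mem_image.1 this
    rcases y with x | j
    · exact ⟨x, hy, hyi⟩
    · have hj : j = i := hyi
      exact absurd (hj ▸ hy) (Finset.mem_filter.1 hi).2
  have hdom : ∀ y : G, ∃ i ∈ C, ∀ x : G, Sum.inl x ∈ D → y.1 i ≤ x.1 i := by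
    intro y
    obtain ⟨i, hi⟩ := hD (Sum.inl y)
    refine ⟨i, Finset.mem_filter.2 ⟨Finset.mem_univ _, fun h => ?_⟩, fun x hx => ?_⟩
    · have := hle _ _ _ (hi _ h)
      simp [w] at this
    · have := hle _ _ _ (hi _ hx)
      simpa [w] using this
  obtain ⟨i₁, hi₁, -⟩ := hdom ⟨Pi.single i₀ K, (hG _).2 (by simp)⟩
  obtain ⟨x₀, hx₀D, -⟩ := hcol i₁ hi₁
  have hmin : ∀ i, ∃ m : G, Sum.inl m ∈ D ∧ ∀ x : G, Sum.inl x ∈ D → m.1 i ≤ x.1 i := by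
    intro i
    obtain ⟨m, hm, hmin⟩ := (Finset.univ.filter fun x : G => Sum.inl x ∈ D).exists_min_image
      (fun x => x.1 i) ⟨x₀, by simpa using hx₀D⟩
    exact ⟨m, by simpa using hm, fun x hx => hmin x (by simpa using hx)⟩
  choose m hmD hm using hmin
  -- Otherwise raise each minimum over `C` by one and put the remainder on `i₁`: this grid point
  -- contradicts `hdom`.
  have hsum : K < ∑ i ∈ C, ((m i).1 i + 1) := by
    by_contra hcon
    push Not at hcon
    let z : ι → ℕ := fun i => if i ∈ C then (m i).1 i + 1 else 0
    have hz : ∑ i, z i = ∑ i ∈ C, ((m i).1 i + 1) := by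
      simp [z, Finset.sum_ite_mem]
    let y : ι → ℕ := z + Pi.single i₁ (K - ∑ i ∈ C, ((m i).1 i + 1))
    have hy : ∑ i, y i = K := by
      have h1 : ∑ i, y i = ∑ i, z i + (K - ∑ i ∈ C, ((m i).1 i + 1)) := by
        simp [y, Finset.sum_add_distrib]
      rw [h1, hz, Nat.add_sub_cancel' hcon]
    obtain ⟨i, hi, hyi⟩ := hdom ⟨y, (hG _).2 hy⟩
    have h1 : y i ≤ (m i).1 i := hyi (m i) (hmD i)
    have h2 : z i = (m i).1 i + 1 := by simp [z, hi]
    have h3 : y i = z i + _ := rfl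
    omega
  have hnear : ∀ x : G, Sum.inl x ∈ D → ∀ i,
      (i ∈ C → x.1 i ≤ (m i).1 i + Fintype.card ι) ∧ (i ∉ C → x.1 i ≤ Fintype.card ι) := by
    intro x hx
    -- `b` lies below `x` and its sum falls short of `K` by less than `card ι`, so no single
    -- coordinate of `x` can exceed it by more.
    let b : ι → ℕ := fun i => if i ∈ C then (m i).1 i else 0
    have hb : ∀ i, b i ≤ x.1 i := by
      intro i
      simp only [b]
      split_ifs
      · exact hm i x hx
      · exact Nat.zero_le _
    have hbsum : K < (∑ i, b i) + Fintype.card ι := by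
      rw [Finset.sum_add_distrib] at hsum
      have h1 : ∑ i, b i = ∑ i ∈ C, (m i).1 i := by simp [b, Finset.sum_ite_mem]
      have h2 : ∑ i ∈ C, 1 ≤ Fintype.card ι := by simpa using C.card_le_univ
      omega
    have key : ∀ i, x.1 i ≤ b i + Fintype.card ι := by
      intro i
      have h1 := (hG x.1).1 x.2
      rw [← Finset.add_sum_erase _ _ (Finset.mem_univ i)] at h1 hbsum
      have h2 : ∑ j ∈ Finset.univ.erase i, b j ≤ ∑ j ∈ Finset.univ.erase i, x.1 j :=
        Finset.sum_le_sum fun j _ => hb j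
      omega
    intro i
    have := key i
    exact ⟨fun hi => by simpa [b, hi] using this, fun hi => by simpa [b, hi] using this⟩
  refine ⟨x₀.1, (hG _).1 x₀.2, fun i => ?_⟩
  by_cases hi : i ∈ C
  · obtain ⟨x, hxD, hxc⟩ := hcol i hi
    refine Or.inr ⟨x.1, (hG _).1 x.2, hxc, fun l => ?_⟩
    by_cases hl : l ∈ C
    · have h1 := (hnear x hxD l).1 hl
      have h2 := (hnear x₀ hx₀D l).1 hl
      have h3 := hm l x hxD
      have h4 := hm l x₀ hx₀D
      omega
    · have h1 := (hnear x hxD l).2 hl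
      have h2 := (hnear x₀ hx₀D l).2 hl
      omega
  · exact Or.inl ((hnear x₀ hx₀D i).2 hi)

/-- On the standard simplex, a continuous self-map has points which it moves up by as little as
desired in every coordinate. -/
theorem exists_sub_le_of_mapsTo_stdSimplex [Nontrivial ι] {f : (ι → ℝ) → ι → ℝ}
    (hf : ContinuousOn f (stdSimplex ℝ ι)) (hmaps : Set.MapsTo f (stdSimplex ℝ ι) (stdSimplex ℝ ι))
    {ε : ℝ} (hε : 0 < ε) : ∃ q ∈ stdSimplex ℝ ι, ∀ i, q i - f q i ≤ ε := by
  have huc : UniformContinuousOn f (stdSimplex ℝ ι) :=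
    (isCompact_stdSimplex ℝ ι).uniformContinuousOn_of_continuous hf
  obtain ⟨δ, hδ, hfδ⟩ := Metric.uniformContinuousOn_iff.1 huc (ε / 2) (by positivity)
  obtain ⟨K, hK⟩ := exists_nat_gt (Fintype.card ι / min (ε / 2) δ)
  have hmin : 0 < min (ε / 2) δ := by positivity
  have hK0 : (0 : ℝ) < K := lt_of_le_of_lt (by positivity) hK
  have hKn : Fintype.card ι / (K : ℝ) < min (ε / 2) δ := by
    rw [div_lt_iff₀ hmin] at hK
    rw [div_lt_iff₀ hK0]
    linarith
  let q : (ι → ℕ) → ι → ℝ := fun x i => x i / K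
  have hq : ∀ x : ι → ℕ, ∑ i, x i = K → q x ∈ stdSimplex ℝ ι := by
    intro x hx
    refine ⟨fun i => by positivity, ?_⟩
    simp only [q]
    rw [← Finset.sum_div, div_eq_one_iff_eq hK0.ne', ← hx]
    push_cast
    rfl
  -- Colour a grid point by a coordinate that `f` does not decrease; one exists because both
  -- coordinate sums are 1.
  have hcol : ∀ x : ι → ℕ, ∃ i, ∑ i, x i = K → q x i ≤ f (q x) i := by
    intro x
    by_cases hx : ∑ i, x i = K
    · have h1 := (hq x hx).2
      have h2 := (hmaps (hq x hx)).2
      obtain ⟨i, -, hi⟩ := Finset.exists_le_of_sum_le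
        (s := (Finset.univ : Finset ι)) Finset.univ_nonempty (h1.trans h2.symm).le
      exact ⟨i, fun _ => hi⟩
    · exact ⟨Classical.arbitrary ι, fun h => absurd h hx⟩
  choose c hc using hcol
  obtain ⟨x₀, hx₀, hnear⟩ := exists_grid_point_near_colors K c
  refine ⟨q x₀, hq x₀ hx₀, fun i => ?_⟩
  rcases hnear i with h | ⟨x, hx, hxc, hxx⟩
  · have h1 : q x₀ i ≤ Fintype.card ι / (K : ℝ) := by
      simp only [q]
      gcongr
    have h2 := (hmaps (hq x₀ hx₀)).1 i
    have h3 := min_le_left (ε / 2) δ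
    linarith
  · have hclose : ∀ l, |q x₀ l - q x l| ≤ Fintype.card ι / (K : ℝ) := by
      intro l
      have h1 : ((x l : ℕ) : ℝ) ≤ x₀ l + Fintype.card ι := mod_cast (hxx l).1
      have h2 : ((x₀ l : ℕ) : ℝ) ≤ x l + Fintype.card ι := mod_cast (hxx l).2
      simp only [q]
      rw [← sub_div, abs_div, abs_of_pos hK0]
      gcongr
      rw [abs_le]
      constructor <;> linarith
    have hdist : dist (q x₀) (q x) < δ := by
      refine (dist_pi_lt_iff hδ).2 fun l => ?_
      rw [Real.dist_eq]
      exact (hclose l).trans_lt (hKn.trans_le (min_le_right _ _))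
    have h1 := hfδ _ (hq x₀ hx₀) _ (hq x hx) hdist
    have h2 := (dist_le_pi_dist (f (q x₀)) (f (q x)) i).trans_lt h1
    rw [Real.dist_eq] at h2
    have h3 := hc x hx
    rw [hxc] at h3
    have h4 := (abs_le.1 (hclose i)).2
    have h5 := (abs_lt.1 h2).1
    have h6 := min_le_left (ε / 2) δ
    linarith

/-- **Brouwer's fixed point theorem** for the standard simplex. -/
theorem exists_fixedPoint_stdSimplex [Nontrivial ι] {f : (ι → ℝ) → ι → ℝ}
    (hf : ContinuousOn f (stdSimplex ℝ ι))
    (hmaps : Set.MapsTo f (stdSimplex ℝ ι) (stdSimplex ℝ ι)) :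
    ∃ q ∈ stdSimplex ℝ ι, f q = q := by
  classical
  obtain ⟨q₀, hq₀, -⟩ := exists_sub_le_of_mapsTo_stdSimplex hf hmaps one_pos
  obtain ⟨p, hp, hpmin⟩ := (isCompact_stdSimplex ℝ ι).exists_isMinOn ⟨q₀, hq₀⟩
    (f := fun q => dist (f q) q) (continuous_dist.comp_continuousOn (hf.prodMk continuousOn_id))
  refine ⟨p, hp, dist_le_zero.1 (le_of_forall_pos_le_add fun ε hε => ?_)⟩
  have hn : (0 : ℝ) < Fintype.card ι := mod_cast Fintype.card_pos
  obtain ⟨q, hq, hqε⟩ := exists_sub_le_of_mapsTo_stdSimplex hf hmaps (div_pos hε hn)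
  refine (hpmin hq).trans ?_
  rw [zero_add]
  refine (dist_pi_le_iff hε.le).2 fun i => ?_
  have hle : ε / Fintype.card ι ≤ ε := div_le_self hε.le (mod_cast Fintype.card_pos)
  -- As the differences sum to 0, upper bounds on the others bound each one from below.
  have hsum : ∑ l, (q l - f q l) = 0 := by
    rw [Finset.sum_sub_distrib, hq.2, (hmaps hq).2, sub_self]
  rw [← Finset.add_sum_erase _ _ (Finset.mem_univ i)] at hsum
  have hrest : ∑ l ∈ Finset.univ.erase i, (q l - f q l) ≤ ε := by
    calc ∑ l ∈ Finset.univ.erase i, (q l - f q l)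
        ≤ ∑ l ∈ Finset.univ.erase i, ε / Fintype.card ι := Finset.sum_le_sum fun l _ => hqε l
      _ ≤ ∑ l : ι, ε / Fintype.card ι :=
        Finset.sum_le_sum_of_subset_of_nonneg (Finset.erase_subset _ _) fun _ _ _ => by positivity
      _ = ε := by
        rw [Finset.sum_const, Finset.card_univ, nsmul_eq_mul]
        field_simp
  rw [Real.dist_eq, abs_le]
  have := hqε i
  constructor <;> linarith

/-- **Brouwer's fixed point theorem** for the unit cube. -/
theorem exists_fixedPoint_cube {g : (ι → ℝ) → ι → ℝ} (hg : Continuous g)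
    (hmaps : Set.MapsTo g (Set.Icc 0 1) (Set.Icc 0 1)) : ∃ q ∈ Set.Icc 0 1, g q = q := by
  classical
  rcases isEmpty_or_nonempty ι with hι | hι
  · exact ⟨0, ⟨le_rfl, zero_le_one⟩, Subsingleton.elim _ _⟩
  have hn : (0 : ℝ) < Fintype.card ι := mod_cast Fintype.card_pos
  -- The cube scaled by `1 / card ι` fits in the simplex, with `none` absorbing the missing mass.
  -- Since `f` lands in the scaled cube, the clamping in `ρ` is inactive at a fixed point.
  let ρ : (Option ι → ℝ) → ι → ℝ := fun q i => max 0 (min (Fintype.card ι * q (some i)) 1)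
  have hρ : ∀ q, ρ q ∈ Set.Icc (0 : ι → ℝ) 1 := fun q =>
    ⟨fun i => le_max_left _ _, fun i => max_le zero_le_one (min_le_right _ _)⟩
  have hρc : Continuous ρ := by fun_prop
  let f : (Option ι → ℝ) → Option ι → ℝ := fun q o =>
    o.elim (1 - ∑ i, g (ρ q) i / Fintype.card ι) (fun i => g (ρ q) i / Fintype.card ι)
  have hfc : Continuous f := by
    refine continuous_pi fun o => ?_
    rcases o with _ | i
    · simp only [f, Option.elim]
      fun_prop
    · simp only [f, Option.elim]
      fun_prop
  have hfm : Set.MapsTo f (stdSimplex ℝ (Option ι)) (stdSimplex ℝ (Option ι)) := by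
    intro q _
    have hgq := hmaps (hρ q)
    refine ⟨fun o => ?_, ?_⟩
    · rcases o with _ | i
      · simp only [f, Option.elim, sub_nonneg]
        rw [← Finset.sum_div, div_le_one hn]
        calc ∑ i, g (ρ q) i ≤ ∑ _i : ι, (1 : ℝ) := Finset.sum_le_sum fun i _ => hgq.2 i
          _ = Fintype.card ι := by simp
      · exact div_nonneg (hgq.1 i) hn.le
    · rw [Fintype.sum_option]
      simp [f]
  obtain ⟨q, hq, hfq⟩ := exists_fixedPoint_stdSimplex hfc.continuousOn hfm
  have hfix : ∀ i, g (ρ q) i = Fintype.card ι * q (some i) := by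
    intro i
    have : g (ρ q) i / Fintype.card ι = q (some i) := congrFun hfq (some i)
    rw [← this]
    field_simp
  refine ⟨ρ q, hρ q, funext fun i => ?_⟩
  have hgq := hmaps (hρ q)
  have h0 : 0 ≤ Fintype.card ι * q (some i) := hfix i ▸ hgq.1 i
  have h1 : Fintype.card ι * q (some i) ≤ 1 := hfix i ▸ hgq.2 i
  rw [hfix i]
  simp only [ρ]
  rw [min_eq_left h1, max_eq_right h0]

end Brouwer

/-! ### Equilateral sets in images of `ℓ_∞` with distortion at most 2 -/

section Equilateral

/-- The points `p_j` of `ℓ_∞^β`, indexed by `WithTop β`: coordinate `u` of `p_j` is `-1` for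
`u = j`, the parameter `ε (u, j)` for `u < j`, and `0` otherwise. -/
def cubePoint {β : Type*} [LinearOrder β] (ε : β × WithTop β → ℝ) (j : WithTop β) (u : β) : ℝ :=
  if (u : WithTop β) = j then -1 else if (u : WithTop β) < j then ε (u, j) else 0

variable {β : Type*} [LinearOrder β] [Fintype β]

theorem continuous_cubePoint (j : WithTop β) :
    Continuous fun ε : β × WithTop β → ℝ => cubePoint ε j := by
  refine continuous_pi fun u => ?_
  unfold cubePoint
  split_ifs <;> fun_prop

theorem cubePoint_mem_Icc {ε : β × WithTop β → ℝ} (hε : ε ∈ Set.Icc 0 1) {j : WithTop β} {u : β}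
    (h : (u : WithTop β) ≠ j) : cubePoint ε j u ∈ Set.Icc (0 : ℝ) 1 := by
  unfold cubePoint
  rw [if_neg h]
  split_ifs
  · exact ⟨hε.1 _, hε.2 _⟩
  · exact ⟨le_rfl, zero_le_one⟩

/-- Coordinate `i` gives the norm. At coordinate `j`, if there is one, the entries are 0 and -1;
everywhere else both lie in `[0, 1]`. -/
theorem norm_cubePoint_sub {ε : β × WithTop β → ℝ} (hε : ε ∈ Set.Icc 0 1) {i : β} {j : WithTop β}
    (hij : (i : WithTop β) < j) : ‖cubePoint ε i - cubePoint ε j‖ = 1 + ε (i, j) := by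
  have h0 : 0 ≤ ε (i, j) := hε.1 _
  have hi : (cubePoint ε i - cubePoint ε j) i = -(1 + ε (i, j)) := by
    simp only [Pi.sub_apply, cubePoint, if_true, if_neg hij.ne, if_pos hij]
    ring
  apply le_antisymm
  · refine (pi_norm_le_iff_of_nonneg (by positivity)).2 fun u => ?_
    by_cases hui : u = i
    · rw [hui, hi, norm_neg, Real.norm_of_nonneg (by positivity)]
    have hui' : (u : WithTop β) ≠ (i : WithTop β) := by simpa using hui
    have h1 := cubePoint_mem_Icc hε hui'
    rw [Pi.sub_apply, Real.norm_eq_abs, abs_le]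
    by_cases huj : (u : WithTop β) = j
    · have h2 : cubePoint ε i u = 0 := by
        unfold cubePoint
        rw [if_neg hui', if_neg]
        rw [huj]
        exact not_lt.2 hij.le
      have h3 : cubePoint ε j u = -1 := by
        unfold cubePoint
        rw [if_pos huj]
      rw [h2, h3]
      constructor <;> linarith
    · have h2 := cubePoint_mem_Icc hε huj
      constructor <;> linarith [h1.1, h1.2, h2.1, h2.2]
  · have := norm_le_pi_norm (cubePoint ε i - cubePoint ε j) i
    rwa [hi, norm_neg, Real.norm_of_nonneg (by positivity)] at this

/-- A linear image of `ℓ_∞^β` with distortion at most `2` contains an equilateral set of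
cardinality `|β| + 1`. -/
theorem card_add_one_le_equilateralDim {Y : Type*} [NormedAddCommGroup Y] [NormedSpace ℝ Y]
    (S : (β → ℝ) →L[ℝ] Y) (hS : ∀ v, ‖S v‖ ≤ ‖v‖) (hS' : ∀ v, ‖v‖ ≤ 2 * ‖S v‖) :
    ((Fintype.card β + 1 : ℕ) : ℕ∞) ≤ equilateralDim Y := by
  -- A fixed point has all image distances equal to 1. The distance lies between `(1 + ε p) / 2` and
  -- `1 + ε p`, so distortion 2 is just what keeps `g` in the cube.
  let g : (β × WithTop β → ℝ) → β × WithTop β → ℝ := fun ε p =>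
    if (p.1 : WithTop β) < p.2 then 1 + ε p - ‖S (cubePoint ε p.1 - cubePoint ε p.2)‖ else 0
  have hg : Continuous g := by
    refine continuous_pi fun p => ?_
    simp only [g]
    split_ifs
    · have h1 := continuous_cubePoint (β := β) (p.1 : WithTop β)
      have h2 := continuous_cubePoint (β := β) p.2
      fun_prop
    · fun_prop
  have hmaps : Set.MapsTo g (Set.Icc 0 1) (Set.Icc 0 1) := by
    intro ε hε
    have key : ∀ p, g ε p ∈ Set.Icc (0 : ℝ) 1 := by
      intro p
      simp only [g]
      split_ifs with h
      · have h1 := hS (cubePoint ε p.1 - cubePoint ε p.2)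
        have h2 := hS' (cubePoint ε p.1 - cubePoint ε p.2)
        rw [norm_cubePoint_sub hε h] at h1 h2
        have h3 : ε p ≤ 1 := hε.2 p
        constructor <;> linarith
      · exact ⟨le_rfl, zero_le_one⟩
    exact ⟨fun p => (key p).1, fun p => (key p).2⟩
  obtain ⟨ε, -, hfix⟩ := exists_fixedPoint_cube hg hmaps
  let y : WithTop β → Y := fun j => S (cubePoint ε j)
  have hlt : ∀ i j : WithTop β, i < j → ‖y i - y j‖ = 1 := by
    intro i j hij
    obtain ⟨i, rfl⟩ := WithTop.ne_top_iff_exists.1 hij.ne_top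
    have h := congrFun hfix (i, j)
    simp only [g, if_pos hij, map_sub] at h
    simp only [y]
    linarith
  have hne : ∀ i j : WithTop β, i ≠ j → ‖y i - y j‖ = 1 := by
    intro i j hij
    rcases lt_or_gt_of_ne hij with h | h
    · exact hlt i j h
    · rw [norm_sub_rev]
      exact hlt j i h
  have hinj : Function.Injective y := by
    intro i j hij
    by_contra h
    have := hne i j h
    rw [hij, sub_self, norm_zero] at this
    exact zero_ne_one this
  have heq : IsEquilateral (Set.range y) := by
    refine ⟨1, one_pos, ?_⟩
    rintro _ ⟨i, rfl⟩ _ ⟨j, rfl⟩ h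
    exact hne i j fun hij => h (by rw [hij])
  have hcard : (Set.range y).encard = ((Fintype.card β + 1 : ℕ) : ℕ∞) := by
    rw [← Set.image_univ, hinj.encard_image, Set.encard_univ, ENat.card_eq_coe_fintype_card]
    congr 1
    exact Fintype.card_option
  rw [← hcard]
  exact le_iSup₂ (f := fun (S : Set Y) (_ : IsEquilateral S) => S.encard) _ heq

end Equilateral

/-! ### Hyperplanes and the Banach–Mazur distance -/

/-- If the coefficients on `A` dominate those on `B`, the hyperplane contains an isometric copy
of `ℓ_∞^B`. -/
theorem exists_isometry_linftyHyperplane {n : ℕ} (a : Fin n → ℝ) {A B : Finset (Fin n)}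
    (hdisj : Disjoint A B) (h : ∑ i ∈ B, |a i| ≤ ∑ i ∈ A, |a i|) :
    ∃ J : (B → ℝ) →ₗ[ℝ] linftyHyperplane a, ∀ v, ‖J v‖ = ‖v‖ := by
  set σ := ∑ i ∈ A, |a i| with hσ
  have hsgn : ∀ i, ∃ s : ℝ, a i * s = |a i| ∧ |s| ≤ 1 := by
    intro i
    rcases abs_cases (a i) with h | h
    · exact ⟨1, by rw [h.1, mul_one], by simp⟩
    · exact ⟨-1, by rw [h.1]; ring, by simp⟩
  choose s hs hs1 using hsgn
  let τ : (B → ℝ) → ℝ := fun v => ∑ m : B, a m * v m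
  -- On `A` all entries have size at most `|τ v / σ|`, with signs chosen so that their weighted sum
  -- is `-τ v`.
  let F : (B → ℝ) → Fin n → ℝ := fun v l =>
    if hl : l ∈ B then v ⟨l, hl⟩ else if l ∈ A then -(s l * (τ v / σ)) else 0
  have hτ : ∀ v, |τ v| ≤ σ * ‖v‖ := by
    intro v
    calc |τ v| ≤ ∑ m : B, |a m * v m| := Finset.abs_sum_le_sum_abs _ _
      _ ≤ ∑ m : B, |a m| * ‖v‖ := by
        refine Finset.sum_le_sum fun m _ => ?_
        rw [abs_mul]
        exact mul_le_mul_of_nonneg_left (norm_le_pi_norm v m) (abs_nonneg _)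
      _ = (∑ i ∈ B, |a i|) * ‖v‖ := by
        rw [← Finset.sum_mul, Finset.sum_coe_sort B fun i => |a i|]
      _ ≤ σ * ‖v‖ := mul_le_mul_of_nonneg_right h (norm_nonneg _)
  have hσ0 : 0 ≤ σ := Finset.sum_nonneg fun _ _ => abs_nonneg _
  -- If `σ = 0` then `τ v = 0` as well, so division by zero does no harm.
  have hστ : ∀ v, σ * (τ v / σ) = τ v := by
    intro v
    by_cases h0 : σ = 0
    · have := hτ v
      rw [h0, zero_mul] at this
      rw [h0, zero_mul, abs_nonpos_iff.1 this]
    · field_simp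
  have hFmem : ∀ v, ∑ i, a i * F v i = 0 := by
    intro v
    have hsplit : ∀ i, a i * F v i = (if hi : i ∈ B then a i * v ⟨i, hi⟩ else 0) +
        (if i ∈ A then -(|a i| * (τ v / σ)) else 0) := by
      intro i
      by_cases hi : i ∈ B
      · have hiA : i ∉ A := fun hA => Finset.disjoint_left.1 hdisj hA hi
        simp [F, hi, hiA]
      · by_cases hiA : i ∈ A
        · simp only [F, hi, hiA, dif_neg, if_true, not_false_eq_true, ← hs]
          ring
        · simp [F, hi, hiA]
    rw [Finset.sum_congr rfl fun i _ => hsplit i, Finset.sum_add_distrib, Finset.sum_ite_mem,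
      Finset.univ_inter, Finset.sum_neg_distrib, ← Finset.sum_mul, ← hσ, hστ]
    have : ∑ i, (if hi : i ∈ B then a i * v ⟨i, hi⟩ else 0) = τ v := by
      rw [Finset.sum_dite]
      simp only [Finset.sum_const_zero, add_zero, τ]
      refine Finset.sum_nbij' (fun i => ⟨i.1, by simpa using i.2⟩) (fun i => ⟨i.1, by simp⟩)
        ?_ ?_ ?_ ?_ ?_ <;> simp
    rw [this]
    ring
  have hadd : ∀ v w, τ (v + w) = τ v + τ w := by
    intro v w
    simp only [τ, Pi.add_apply, mul_add, Finset.sum_add_distrib]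
  have hsmul : ∀ (c : ℝ) v, τ (c • v) = c * τ v := by
    intro c v
    simp only [τ, Pi.smul_apply, smul_eq_mul, Finset.mul_sum]
    exact Finset.sum_congr rfl fun _ _ => by ring
  let J : (B → ℝ) →ₗ[ℝ] linftyHyperplane a :=
    { toFun := fun v => ⟨F v, hFmem v⟩
      map_add' := by
        intro v w
        refine Subtype.ext (funext fun l => ?_)
        change F (v + w) l = F v l + F w l
        simp only [F, hadd]
        split_ifs
        · rfl
        · ring
        · ring
      map_smul' := by
        intro c v
        refine Subtype.ext (funext fun l => ?_)
        change F (c • v) l = c * F v l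
        simp only [F, hsmul]
        split_ifs
        · rfl
        · ring
        · ring }
  refine ⟨J, fun v => ?_⟩
  change ‖F v‖ = ‖v‖
  apply le_antisymm
  · refine (pi_norm_le_iff_of_nonneg (norm_nonneg _)).2 fun l => ?_
    simp only [F]
    split_ifs
    · exact norm_le_pi_norm v _
    · have h1 : |τ v / σ| ≤ ‖v‖ := by
        rw [abs_div, abs_of_nonneg hσ0]
        exact div_le_of_le_mul₀ hσ0 (norm_nonneg _) (by rw [mul_comm]; exact hτ v)
      rw [norm_neg, norm_mul, Real.norm_eq_abs, Real.norm_eq_abs]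
      calc |s l| * |τ v / σ| ≤ 1 * ‖v‖ :=
            mul_le_mul (hs1 l) h1 (abs_nonneg _) zero_le_one
        _ = ‖v‖ := one_mul _
    · simp
  · refine (pi_norm_le_iff_of_nonneg (norm_nonneg _)).2 fun m => ?_
    have h1 := norm_le_pi_norm (F v) m
    simpa [F] using h1

/-- In finite dimension a bound on the Banach–Mazur distance is realised by a linear map. -/
theorem exists_linearMap_of_banachMazurDist_le {E F : Type*} [NormedAddCommGroup E]
    [NormedSpace ℝ E] [FiniteDimensional ℝ E] [NormedAddCommGroup F] [NormedSpace ℝ F] {d : ℝ}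
    (hd : 0 ≤ d) (h : banachMazurDist E F ≤ ENNReal.ofReal d) :
    ∃ T : E →L[ℝ] F, (∀ v, ‖T v‖ ≤ ‖v‖) ∧ ∀ v, ‖v‖ ≤ d * ‖T v‖ := by
  have happrox : ∀ δ : ℝ, 0 < δ → ∃ T : E ≃L[ℝ] F,
      ‖(T : E →L[ℝ] F)‖ * ‖(T.symm : F →L[ℝ] E)‖ < d + δ := by
    intro δ hδ
    have hlt : banachMazurDist E F < ENNReal.ofReal (d + δ) :=
      h.trans_lt ((ENNReal.ofReal_lt_ofReal_iff (by positivity)).2 (by linarith))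
    obtain ⟨T, hT⟩ := iInf_lt_iff.1 hlt
    exact ⟨T, (ENNReal.ofReal_lt_ofReal_iff (by positivity)).1 hT⟩
  obtain ⟨T₀, -⟩ := happrox 1 one_pos
  have : FiniteDimensional ℝ F := T₀.toLinearEquiv.finiteDimensional
  have : ProperSpace (E →L[ℝ] F) := FiniteDimensional.proper ℝ _
  -- Near-optimal isomorphisms, scaled to norm at most 1, lie in a compact ball; both inequalities
  -- pass to a limit.
  have hnorm : ∀ k : ℕ, ∃ T : E →L[ℝ] F, ‖T‖ ≤ 1 ∧
      ∀ v, ‖v‖ ≤ (d + 1 / ((k : ℝ) + 1)) * ‖T v‖ := by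
    intro k
    obtain ⟨T, hT⟩ := happrox (1 / ((k : ℝ) + 1)) (by positivity)
    have hv : ∀ v, ‖v‖ ≤ ‖(T.symm : F →L[ℝ] E)‖ * ‖T v‖ := by
      intro v
      simpa using (T.symm : F →L[ℝ] E).le_opNorm (T v)
    by_cases h0 : ‖(T : E →L[ℝ] F)‖ = 0
    · refine ⟨0, by simp, fun v => ?_⟩
      have h1 : T v = 0 := by
        have := (T : E →L[ℝ] F).le_opNorm v
        rw [h0, zero_mul] at this
        simpa using norm_le_zero_iff.1 this
      have h2 := hv v
      rw [h1, norm_zero, mul_zero] at h2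
      simpa using h2
    · refine ⟨‖(T : E →L[ℝ] F)‖⁻¹ • (T : E →L[ℝ] F), ?_, fun v => ?_⟩
      · rw [norm_smul, norm_inv, norm_norm, inv_mul_cancel₀ h0]
      · have h1 : ‖T v‖ = ‖(T : E →L[ℝ] F)‖ * ‖(‖(T : E →L[ℝ] F)‖⁻¹ • (T : E →L[ℝ] F)) v‖ := by
          rw [smul_apply, norm_smul, norm_inv, norm_norm, mul_inv_cancel_left₀ h0]
          rfl
        calc ‖v‖ ≤ ‖(T.symm : F →L[ℝ] E)‖ * ‖T v‖ := hv v
          _ = (‖(T : E →L[ℝ] F)‖ * ‖(T.symm : F →L[ℝ] E)‖) *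
              ‖(‖(T : E →L[ℝ] F)‖⁻¹ • (T : E →L[ℝ] F)) v‖ := by rw [h1]; ring
          _ ≤ _ := mul_le_mul_of_nonneg_right hT.le (norm_nonneg _)
  choose T hT1 hT2 using hnorm
  obtain ⟨S, hS, φ, hφ, hlim⟩ := (isCompact_closedBall (0 : E →L[ℝ] F) 1).tendsto_subseq
    (x := T) fun k => by simpa using hT1 k
  refine ⟨S, fun v => ?_, fun v => ?_⟩
  · have h1 : ‖S‖ ≤ 1 := by simpa using hS
    simpa using S.le_of_opNorm_le h1 v
  · have h1 : Filter.Tendsto (fun k => ‖T (φ k) v‖) Filter.atTop (nhds ‖S v‖) :=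
      (((ContinuousLinearMap.apply ℝ F v).continuous.tendsto S).comp hlim).norm
    have h2 : Filter.Tendsto (fun k => d + 1 / ((φ k : ℝ) + 1)) Filter.atTop (nhds (d + 0)) :=
      ((tendsto_one_div_add_atTop_nhds_zero_nat (𝕜 := ℝ)).comp hφ.tendsto_atTop).const_add d
    have h3 := h2.mul h1
    rw [add_zero] at h3
    exact ge_of_tendsto' h3 fun k => hT2 (φ k) v

theorem theorem1p10 (n k : ℕ) (a : Fin n → ℝ)
    (hX : Module.finrank ℝ (linftyHyperplane a) + 1 = n)
    (hk1 : 1 ≤ k) (hkn : k ≤ n)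
    (hAB : ∃ A B : Finset (Fin n), Disjoint A B ∧ A.card = k ∧ (A ∪ B).card = n - 1 ∧
      ∑ i ∈ B, |a i| ≤ ∑ i ∈ A, |a i|)
    (Y : Type*) [NormedAddCommGroup Y] [NormedSpace ℝ Y]
    (hY : banachMazurDist (linftyHyperplane a) Y ≤ 2) :
    ((n - k : ℕ) : ℕ∞) ≤ equilateralDim Y := by
  obtain ⟨A, B, hdisj, hA, hunion, hsum⟩ := hAB
  rw [Finset.card_union_of_disjoint hdisj, hA] at hunion
  obtain ⟨J, hJ⟩ := exists_isometry_linftyHyperplane a hdisj hsum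
  obtain ⟨T, hT, hT'⟩ := exists_linearMap_of_banachMazurDist_le (d := 2) zero_le_two
    (by simpa using hY)
  have key := card_add_one_le_equilateralDim (T.comp (LinearMap.toContinuousLinearMap J))
    (fun v => by simpa [hJ] using hT (J v)) (fun v => by simpa [hJ] using hT' (J v))
  refine le_trans ?_ key
  rw [Fintype.card_coe]
  -- The extra point indexed by `⊤` makes up for the one index outside `A ∪ B`.
  exact_mod_cast (by omega : n - k ≤ B.card + 1)
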